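/- All rings are commutative with identity. For a ring $R$, let $\mathcal{EG}(R)$ be the simple graph whose vertices are the non-zero ideals of $R$ with non-zero annihilator, two distinct vertices $I,J$ being adjacent if and only if $\mathrm{Ann}(IJ)$ is an essential ideal, i.e. a non-zero ideal that has non-zero intersection with every non-zero ideal of $R$. A graph $G$ of finite maximum degree $\Delta(G)$ is called Class $2$ if $\chi'(G)=\Delta(G)+1$, where the edge chromatic number $\chi'(G)$ is the least number of colors in an edge coloring in which any two distinct edges sharing an endpoint have different colors. Let $R=R_1\times R_2$, where, for $i=1,2$, $R_i$ is an Artinian local ring with exactly $t_i$ proper ideals (the zero ideal included), and $t_i\geq 2$ is an even integer. Then $\mathcal{EG}(R)$ is Class $2$ if and only if $t_1=t_2=2$. -/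

import Mathlib

/-- An ideal is essential if it is non-zero and meets every non-zero ideal non-trivially. -/
def Ideal.IsEssentialIdeal {R : Type*} [CommRing R] (I : Ideal R) : Prop :=
  I ≠ ⊥ ∧ ∀ J : Ideal R, J ≠ ⊥ → I ⊓ J ≠ ⊥

/-- The non-zero ideals with non-zero annihilator. -/
def NonzeroAnnihilatingIdeal (R : Type*) [CommRing R] : Type _ :=
  {I : Ideal R // I ≠ ⊥ ∧ Submodule.annihilator I ≠ ⊥}

/-- The essential annihilating-ideal graph of `R`: distinct vertices `I`, `J` are adjacent
if and only if `Ann(IJ)` is an essential ideal. -/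
def essentialAnnihilatingIdealGraph (R : Type*) [CommRing R] :
    SimpleGraph (NonzeroAnnihilatingIdeal R) where
  Adj I J := I ≠ J ∧ (Submodule.annihilator (I.1 * J.1)).IsEssentialIdeal
  symm := ⟨fun I J h => ⟨h.1.symm, by rw [mul_comm]; exact h.2⟩⟩
  loopless := ⟨fun _ h => h.1 rfl⟩

namespace SimpleGraph

/-- The maximum degree, with value `⊤` if the degrees are not bounded by a natural number. -/
noncomputable def supDegree {V : Type*} (G : SimpleGraph V) : ℕ∞ :=
  ⨆ v : V, (G.neighborSet v).encard

/-- The edge chromatic number: the least number of colors in a coloring of the edges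
for which distinct edges with a common endpoint get distinct colors (`⊤` if no finite number
of colors suffices). -/
noncomputable def edgeChromaticNumber {V : Type*} (G : SimpleGraph V) : ℕ∞ :=
  G.lineGraph.chromaticNumber

/-- A graph is Class 2 if its maximum degree is finite and its edge chromatic number is the
maximum degree plus one. (Graphs of unbounded degree count as Class 1.) -/
def IsClassTwo {V : Type*} (G : SimpleGraph V) : Prop :=
  G.supDegree ≠ ⊤ ∧ G.edgeChromaticNumber = G.supDegree + 1

end SimpleGraph

/-! In an Artinian local ring the annihilator of a proper ideal contains the annihilator of the
maximal ideal, which meets every non-zero ideal; so `Ann I` is essential exactly when `I ≠ ⊤`. Hence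
two vertices of the graph of `R₁ × R₂` are non-adjacent only if both have first coordinate `⊤` or
both have second coordinate `⊤`. The graph is complete on `t₁ t₂ + t₁ + t₂ - 1 = 2 m + 1` vertices
with two disjoint cliques, of sizes `t₁` and `t₂`, removed; its maximum degree is `2 m`.

A colour class has at most `m` edges, so `2 m` colours cannot suffice if fewer than `m` edges are
missing. This happens only for `t₁ = t₂ = 2`.

Otherwise keep just `m` missing edges, forming a graph `D` inside a set `S` of at most `m + 1`
vertices. Then `Dᶜ` has `2 m * m` edges, so each colour must miss exactly one vertex, and `v` must
be missed by `D.degree v` colours. Taking the darts of `D` as colours, each to be missed at its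
source, meets this demand. Edges inside `S` are coloured greedily (`exists_sym2_coloring_avoiding`);
the other vertices are added one by one (`exists_insert`), the colours at each new vertex coming
from Birkhoff's theorem (`exists_injOn_mem_forall_card_eq`). -/

/-! ### Distinct representatives through Birkhoff's theorem -/

open Finset in
/-- In a bipartite graph given by lists of size `j`, with each colour in at most `j` lists, there is
a system of distinct representatives using every colour that lies in exactly `j` lists. -/
theorem exists_injOn_mem_forall_card_eq {V K : Type*} [DecidableEq V] [Fintype K] [DecidableEq K]
    [Nonempty K] (P : Finset V) (L : V → Finset K) (j : ℕ) (hj : 1 ≤ j) (hL : ∀ p ∈ P, #(L p) = j)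
    (hy : ∀ c, #{p ∈ P | c ∈ L p} ≤ j) (hK : Fintype.card K + 1 = #P + j) :
    ∃ g : V → K, (∀ p ∈ P, g p ∈ L p) ∧ Set.InjOn g P ∧
      ∀ c, #{p ∈ P | c ∈ L p} = j → ∃ p ∈ P, g p = c := by
  have hcard : Fintype.card K = Fintype.card (P ⊕ Fin (j - 1)) := by
    simp; omega
  let e : K ≃ P ⊕ Fin (j - 1) := Fintype.equivOfCardEq hcard
  set y : K → ℕ := fun c => #{p ∈ P | c ∈ L p} with hydef
  -- Row `p` is uniform on `L p`; the `j - 1` dummy rows share each deficit `j - y c` equally, which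
  -- makes the matrix doubly stochastic. A permutation in its support gives `g`: a colour in exactly
  -- `j` lists has deficit 0, so no dummy row can take it.
  let w : P ⊕ Fin (j - 1) → K → ℚ := fun i c =>
    i.elim (fun p : P => if c ∈ L p then 1 / (j : ℚ) else 0)
      (fun _ => ((j : ℚ) - y c) / (j * (j - 1)))
  have hj0 : (0 : ℚ) < j := by exact_mod_cast hj
  have hj1 : (0 : ℚ) ≤ (j : ℚ) - 1 := by
    have : (1 : ℚ) ≤ j := by exact_mod_cast hj
    linarith
  have hyle : ∀ c, (0 : ℚ) ≤ (j : ℚ) - y c := fun c => by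
    have : (y c : ℚ) ≤ j := by exact_mod_cast hy c
    linarith
  have hsumy : ∑ c, y c = #P * j := by
    have h := Finset.sum_card_bipartiteAbove_eq_sum_card_bipartiteBelow
      (s := P) (t := (univ : Finset K)) (fun p c => c ∈ L p)
    simp only [Finset.bipartiteAbove, Finset.bipartiteBelow] at h
    rw [hydef, ← h, Finset.sum_const_nat]
    intro p hp
    rw [← hL p hp]
    congr 1
    ext; simp
  have hdef : ∑ c, ((j : ℚ) - y c) = j * (j - 1) := by
    have h1 : (Fintype.card K : ℚ) + 1 = #P + j := by exact_mod_cast hK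
    have h2 : (∑ c, (y c : ℚ)) = #P * j := by exact_mod_cast hsumy
    rw [Finset.sum_sub_distrib, h2, Finset.sum_const, Finset.card_univ, nsmul_eq_mul]
    have : (Fintype.card K : ℚ) = #P + j - 1 := by linarith
    rw [this]; ring
  have hsumP : ∀ c, ∑ p : P, (if c ∈ L p then 1 / (j : ℚ) else 0) = y c / j := by
    intro c
    rw [Finset.sum_coe_sort P (fun p => if c ∈ L p then 1 / (j : ℚ) else 0), ← Finset.sum_filter,
      Finset.sum_const, nsmul_eq_mul]
    ring
  have hM : (Matrix.of fun k c => w (e k) c) ∈ doublyStochastic ℚ K := by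
    rw [mem_doublyStochastic_iff_sum]
    refine ⟨fun k c => ?_, fun k => ?_, fun c => ?_⟩
    · simp only [Matrix.of_apply, w]
      rcases e k with p | i
      · simp only [Sum.elim_inl]; split_ifs <;> positivity
      · simp only [Sum.elim_inr]
        exact div_nonneg (hyle c) (mul_nonneg hj0.le hj1)
    · simp only [Matrix.of_apply, w]
      rcases e k with p | i
      · simp only [Sum.elim_inl]
        rw [← Finset.sum_filter, Finset.sum_const]
        have : #({c | c ∈ L p} : Finset K) = j := by
          rw [← hL p p.2]; congr 1; ext; simp
        rw [this, nsmul_eq_mul]; field_simp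
      · simp only [Sum.elim_inr]
        rw [← Finset.sum_div, hdef]
        have : 1 ≤ j - 1 := by have := i.2; omega
        have : (0 : ℚ) < (j : ℚ) - 1 := by
          have : (2 : ℚ) ≤ j := by exact_mod_cast (by omega : 2 ≤ j)
          linarith
        field_simp
    · simp only [Matrix.of_apply]
      rw [e.sum_comp (fun i => w i c), Fintype.sum_sum_type]
      simp only [w, Sum.elim_inl, Sum.elim_inr, hsumP, Finset.sum_const, Finset.card_univ,
        Fintype.card_fin, nsmul_eq_mul]
      rw [Nat.cast_sub hj, Nat.cast_one]
      -- For `j = 1` there are no dummy rows; the deficits sum to 0, so each vanishes and the column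
      -- sum is `y c / j = 1`.
      rcases hj1.eq_or_lt with h | h
      · rw [← h, mul_zero] at hdef
        have := (Finset.sum_eq_zero_iff_of_nonneg (fun c _ => hyle c)).1 hdef c (mem_univ c)
        rw [← h]
        have h3 : (y c : ℚ) = j := by linarith
        rw [h3]; field_simp; simp
      · field_simp
        ring
  obtain ⟨x, hx0, hx1, hxM⟩ := exists_eq_sum_perm_of_mem_doublyStochastic hM
  obtain ⟨σ, hσ⟩ : ∃ σ, 0 < x σ := by
    by_contra! h
    have : ∑ σ, x σ ≤ 0 := Finset.sum_nonpos fun σ _ => h σ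
    linarith
  have hpos : ∀ k, 0 < w (e k) (σ k) := by
    intro k
    have h1 := congrFun (congrFun hxM k) (σ k)
    rw [Matrix.sum_apply] at h1
    simp only [Matrix.of_apply] at h1
    rw [← h1]
    refine lt_of_lt_of_le ?_ (Finset.single_le_sum
      (f := fun τ : Equiv.Perm K => (x τ • τ.permMatrix ℚ) k (σ k)) (fun τ _ => ?_) (mem_univ σ))
    · simpa [Equiv.toPEquiv_apply] using hσ
    · simp only [Matrix.smul_apply, PEquiv.toMatrix_apply, smul_eq_mul]
      refine mul_nonneg (hx0 τ) ?_
      split_ifs <;> norm_num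
  obtain ⟨k₀⟩ := ‹Nonempty K›
  refine ⟨fun v => if h : v ∈ P then σ (e.symm (Sum.inl ⟨v, h⟩)) else k₀, ?_, ?_, ?_⟩
  · intro p hp
    have := hpos (e.symm (Sum.inl ⟨p, hp⟩))
    simp only [Equiv.apply_symm_apply, w, Sum.elim_inl] at this
    simp only [hp, dif_pos]
    by_contra hc
    simp [hc] at this
  · intro p hp q hq h
    simp only [Finset.mem_coe] at hp hq
    simpa [hp, hq] using h
  · intro c hc
    have h := hpos (σ.symm c)
    simp only [Equiv.apply_symm_apply, w] at h
    rcases he : e (σ.symm c) with p | i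
    · refine ⟨p, p.2, ?_⟩
      simp [← he]
    · rw [he, Sum.elim_inr] at h
      have : y c = j := hc
      simp [this] at h

/-! ### Extending an edge colouring vertex by vertex -/

open Finset in
/-- A proper colouring `c` of the edges of `G` inside `P`, with lists `L` of `j` further colours
at each vertex of `P`, such that each colour lies in at most `j` lists, their number having the
parity of `j`. -/
structure SimpleGraph.IsListedColoring {V K : Type*} [DecidableEq K] (G : SimpleGraph V)
    (P : Finset V) (j : ℕ) (c : V → V → K) (L : V → Finset K) : Prop where
  symm : ∀ x y, c x y = c y x
  proper : ∀ x ∈ P, ∀ y ∈ P, ∀ z ∈ P, G.Adj x y → G.Adj x z → y ≠ z → c x y ≠ c x z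
  avoid : ∀ x ∈ P, ∀ y ∈ P, G.Adj x y → c x y ∉ L x
  card_list : ∀ x ∈ P, #(L x) = j
  card_le : ∀ k, #{x ∈ P | k ∈ L x} ≤ j
  parity : ∀ k, #{x ∈ P | k ∈ L x} % 2 = j % 2

-- The edge from `u` to `p` gets colour `g p`, and `u` lists the colours not used by `g`. A used
-- colour loses one list and an unused one gains `u`. Colours in `j + 1` lists are all used; by
-- parity any other colour is in at most `j - 1` lists, so the bound `j` survives.
open Finset in
theorem SimpleGraph.IsListedColoring.exists_insert {V K : Type*} [DecidableEq V] [Fintype K]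
    [DecidableEq K] [Nonempty K] {G : SimpleGraph V} {P : Finset V} {j : ℕ} {c : V → V → K}
    {L : V → Finset K} (h : G.IsListedColoring P (j + 1) c L) (hK : Fintype.card K = #P + j)
    {u : V} (hu : u ∉ P) :
    ∃ (c' : V → V → K) (L' : V → Finset K), G.IsListedColoring (insert u P) j c' L' := by
  obtain ⟨g, hgL, hginj, hgsurj⟩ := exists_injOn_mem_forall_card_eq P L (j + 1) (by omega)
    h.card_list h.card_le (by omega)
  have hne : ∀ x ∈ P, x ≠ u := fun x hx e => hu (e ▸ hx)
  have hcount : ∀ k, #{x ∈ insert u P | k ∈ if x = u then univ \ P.image g else (L x).erase (g x)}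
      = (if k ∈ P.image g then 0 else 1) + #{x ∈ P | k ∈ L x ∧ g x ≠ k} := by
    intro k
    have h1 : ({x ∈ P | k ∈ if x = u then univ \ P.image g else (L x).erase (g x)} : Finset V) =
        {x ∈ P | k ∈ L x ∧ g x ≠ k} := by
      refine Finset.filter_congr fun x hx => ?_
      rw [if_neg (hne x hx), Finset.mem_erase, and_comm, ne_comm]
    rw [Finset.filter_insert, h1]
    by_cases hk : k ∈ P.image g
    · simp only [hk, if_true, Finset.mem_sdiff]
      simp
    · simp only [hk, if_true, Finset.mem_sdiff]
      rw [if_pos (by simp), if_neg (by simp), Finset.card_insert_of_notMem (by simp [hu])]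
      omega
  have hcase : ∀ k, (#{x ∈ insert u P |
      k ∈ if x = u then univ \ P.image g else (L x).erase (g x)} + 1 = #{x ∈ P | k ∈ L x}) ∨
      (#{x ∈ insert u P | k ∈ if x = u then univ \ P.image g else (L x).erase (g x)}
        = #{x ∈ P | k ∈ L x} + 1 ∧ #{x ∈ P | k ∈ L x} ≠ j + 1) := by
    intro k
    rw [hcount]
    by_cases hk : k ∈ P.image g
    · left
      obtain ⟨p, hp, rfl⟩ := Finset.mem_image.1 hk
      have h2 : ({x ∈ P | g p ∈ L x ∧ g x ≠ g p} : Finset V) =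
          ({x ∈ P | g p ∈ L x} : Finset V).erase p := by
        ext x
        simp only [Finset.mem_filter, Finset.mem_erase]
        constructor
        · rintro ⟨hx, h1, h2⟩
          exact ⟨fun e => h2 (e ▸ rfl), hx, h1⟩
        · rintro ⟨h1, hx, h2⟩
          exact ⟨hx, h2, fun e => h1 (hginj hx hp e)⟩
      rw [if_pos hk, h2, zero_add, Finset.card_erase_add_one]
      simp [hp, hgL p hp]
    · right
      have h2 : ({x ∈ P | k ∈ L x ∧ g x ≠ k} : Finset V) = {x ∈ P | k ∈ L x} := by
        refine Finset.filter_congr fun x hx => and_iff_left ?_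
        rintro rfl
        exact hk (Finset.mem_image_of_mem g hx)
      rw [if_neg hk, h2]
      refine ⟨add_comm _ _, fun e => hk ?_⟩
      obtain ⟨p, hp, e⟩ := hgsurj k e
      exact Finset.mem_image.2 ⟨p, hp, e⟩
  refine ⟨fun x y => if x = u then g y else if y = u then g x else c x y,
    fun x => if x = u then univ \ P.image g else (L x).erase (g x), ?_, ?_, ?_, ?_, ?_, ?_⟩
  · intro x y
    have := h.symm x y
    by_cases hx : x = u <;> by_cases hy : y = u <;> simp [hx, hy, this]
  · intro x hx y hy z hz hxy hxz hyz
    rw [Finset.mem_insert] at hx hy hz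
    rcases hx with rfl | hx
    · have hy := hy.resolve_left hxy.ne'
      have hz := hz.resolve_left hxz.ne'
      simpa using fun e => hyz (hginj hy hz e)
    · have hxu := hne x hx
      rcases hy with rfl | hy
      · have hz := hz.resolve_left hyz.symm
        have hzu := hne z hz
        simp only [hxu, hzu, if_false, if_true]
        intro e
        exact h.avoid x hx z hz hxz (e ▸ hgL x hx)
      · have hyu := hne y hy
        rcases hz with rfl | hz
        · simp only [hxu, hyu, if_false, if_true]
          intro e
          exact h.avoid x hx y hy hxy (e ▸ hgL x hx)
        · have hzu := hne z hz
          simpa only [hxu, hyu, hzu, if_false] using h.proper x hx y hy z hz hxy hxz hyz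
  · intro x hx y hy hxy
    rw [Finset.mem_insert] at hx hy
    rcases hx with rfl | hx
    · have hy := hy.resolve_left hxy.ne'
      simpa using ⟨y, hy, rfl⟩
    · have hxu := hne x hx
      rcases hy with rfl | hy
      · simp [hxu]
      · have hyu := hne y hy
        simp only [hxu, hyu, if_false]
        exact fun e => h.avoid x hx y hy hxy (Finset.mem_of_mem_erase e)
  · intro x hx
    rw [Finset.mem_insert] at hx
    rcases hx with rfl | hx
    · rw [if_pos rfl, Finset.card_sdiff_of_subset (Finset.subset_univ _), Finset.card_univ,
        Finset.card_image_of_injOn hginj]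
      omega
    · rw [if_neg (hne x hx), Finset.card_erase_of_mem (hgL x hx), h.card_list x hx]
      rfl
  · intro k
    have h1 := h.card_le k
    have h2 := h.parity k
    rcases hcase k with h3 | ⟨h3, h4⟩ <;> omega
  · intro k
    have h2 := h.parity k
    rcases hcase k with h3 | ⟨h3, h4⟩ <;> omega

open Finset in
/-- A listed colouring extends to a proper edge colouring of the whole graph. -/
theorem SimpleGraph.IsListedColoring.exists_univ {V K : Type*} [Fintype V] [Fintype K]
    [DecidableEq K] [Nonempty K] {G : SimpleGraph V} (j : ℕ) {P : Finset V} {c : V → V → K}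
    {L : V → Finset K} (h : G.IsListedColoring P j c L) (hV : Fintype.card V = #P + j)
    (hK : Fintype.card K + 1 = Fintype.card V) :
    ∃ c : V → V → K, (∀ x y, c x y = c y x) ∧
      ∀ x y z, G.Adj x y → G.Adj x z → y ≠ z → c x y ≠ c x z := by
  classical
  induction j generalizing P c L with
  | zero =>
    obtain rfl : P = univ := by rw [← Finset.card_eq_iff_eq_univ]; omega
    exact ⟨c, h.symm, fun x y z => h.proper x (mem_univ x) y (mem_univ y) z (mem_univ z)⟩
  | succ j ih =>
    obtain ⟨u, hu⟩ : ∃ u, u ∉ P := by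
      by_contra! hP
      have := Finset.card_eq_iff_eq_univ P |>.2 (Finset.eq_univ_of_forall hP)
      omega
    obtain ⟨c', L', h'⟩ := h.exists_insert (by omega) hu
    refine ih h' ?_
    rw [Finset.card_insert_of_notMem hu]; omega

/-- A symmetric proper colouring of the adjacent pairs is a colouring of the line graph. -/
theorem SimpleGraph.lineGraph_colorable_of_symm {V K : Type*} [Fintype K] {G : SimpleGraph V}
    (c : V → V → K) (hs : ∀ x y, c x y = c y x)
    (hc : ∀ x y z, G.Adj x y → G.Adj x z → y ≠ z → c x y ≠ c x z) :
    G.lineGraph.Colorable (Fintype.card K) := by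
  refine (SimpleGraph.Coloring.mk (fun e : G.edgeSet => Sym2.lift ⟨c, hs⟩ e.1) ?_).colorable
  rintro ⟨e, he⟩ ⟨f, hf⟩ ⟨hne, x, hxe, hxf⟩
  obtain ⟨y, rfl⟩ := Sym2.mem_iff_exists.1 hxe
  obtain ⟨z, rfl⟩ := Sym2.mem_iff_exists.1 hxf
  refine hc x y z he hf ?_
  rintro rfl
  exact hne rfl

/-! ### Greedy colouring and matchings -/

open Finset in
/-- Greedy list-avoiding edge colouring. -/
theorem exists_sym2_coloring_avoiding {V K : Type*} [DecidableEq V] [Fintype K] [DecidableEq K]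
    [Nonempty K] (F : V → Finset K) (d : ℕ) (hK : 2 * d < Fintype.card K + 2)
    (E : Finset (Sym2 V)) (hE : ∀ v, (∃ e ∈ E, v ∈ e) → #(F v) + #{e ∈ E | v ∈ e} ≤ d) :
    ∃ c : Sym2 V → K, ∀ e ∈ E, ∀ v ∈ e, c e ∉ F v ∧ ∀ f ∈ E, v ∈ f → f ≠ e → c e ≠ c f := by
  induction E using Finset.induction_on with
  | empty => exact ⟨fun _ => Classical.arbitrary K, by simp⟩
  | insert e E he ih =>
    obtain ⟨c, hc⟩ := ih fun v ⟨f, hf, hvf⟩ => by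
      refine le_trans ?_ (hE v ⟨f, Finset.mem_insert_of_mem hf, hvf⟩)
      gcongr
      exact Finset.subset_insert _ _
    let B : V → Finset K := fun v => F v ∪ image c {f ∈ E | v ∈ f}
    have hB : ∀ v ∈ e, #(B v) + 1 ≤ d := by
      intro v hv
      refine le_trans ?_ (hE v ⟨e, Finset.mem_insert_self _ _, hv⟩)
      rw [Finset.filter_insert, if_pos hv, Finset.card_insert_of_notMem (by simp [he]), ← add_assoc]
      gcongr
      exact (Finset.card_union_le _ _).trans (by gcongr; exact Finset.card_image_le)
    -- Each end of `e` forbids at most `d - 1` colours, and `2 (d - 1)` is less than the number of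
    -- colours.
    obtain ⟨k, hk⟩ : ∃ k, ∀ v ∈ e, k ∉ B v := by
      induction e using Sym2.ind with
      | _ x y =>
        have h1 := hB x (by simp)
        have h2 := hB y (by simp)
        have h3 := Finset.card_union_le (B x) (B y)
        obtain ⟨k, hk⟩ : ∃ k, k ∉ B x ∪ B y := by
          by_contra! h
          have := (Finset.card_eq_iff_eq_univ _).2 (Finset.eq_univ_of_forall h)
          omega
        refine ⟨k, fun v hv => ?_⟩
        rw [Finset.mem_union, not_or] at hk
        rcases Sym2.mem_iff.1 hv with rfl | rfl
        exacts [hk.1, hk.2]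
    have hkF : ∀ v ∈ e, k ∉ F v := fun v hv h => hk v hv (Finset.mem_union_left _ h)
    have hkE : ∀ v ∈ e, ∀ f ∈ E, v ∈ f → k ≠ c f := fun v hv f hf hvf h =>
      hk v hv (Finset.mem_union_right _ (Finset.mem_image.2 ⟨f, by simp [hf, hvf], h.symm⟩))
    have hne : ∀ f ∈ E, f ≠ e := fun f hf h => he (h ▸ hf)
    refine ⟨Function.update c e k, fun f hf v hv => ?_⟩
    rcases Finset.mem_insert.1 hf with rfl | hf
    · rw [Function.update_self]
      refine ⟨hkF v hv, fun f' hf' hvf' hne' => ?_⟩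
      rw [Function.update_of_ne hne']
      exact hkE v hv f' ((Finset.mem_insert.1 hf').resolve_left hne') hvf'
    · have hfE := hf
      rw [Function.update_of_ne (hne f hf)]
      refine ⟨(hc f hfE v hv).1, fun f' hf' hvf' hne' => ?_⟩
      rcases Finset.mem_insert.1 hf' with rfl | hf'
      · rw [Function.update_self]
        exact (hkE v hvf' f hfE hv).symm
      · rw [Function.update_of_ne (hne f' hf')]
        exact (hc f hfE v hv).2 f' hf' hvf' hne'

-- Applied to colour classes, this handshake count yields both the parity of the list counts and the
-- bound of `m` edges per colour.
open Finset Classical in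
theorem SimpleGraph.card_exists_adj_eq_two_mul_of_unique {V : Type*} [Fintype V]
    (H : SimpleGraph V) (h : ∀ x y z, H.Adj x y → H.Adj x z → y = z) :
    #{x | ∃ y, H.Adj x y} = 2 * #H.edgeFinset := by
  rw [← H.sum_degrees_eq_twice_card_edges, Finset.card_filter]
  refine Finset.sum_congr rfl fun x _ => ?_
  split_ifs with hx
  · obtain ⟨y, hy⟩ := hx
    rw [← H.card_neighborFinset_eq_degree, eq_comm, Finset.card_eq_one]
    refine ⟨y, Finset.ext fun z => ?_⟩
    rw [H.mem_neighborFinset, Finset.mem_singleton]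
    exact ⟨fun hz => h x z y hz hy, fun e => e ▸ hy⟩
  · rw [← H.card_neighborFinset_eq_degree, eq_comm, Finset.card_eq_zero]
    refine Finset.eq_empty_of_forall_notMem fun z hz => hx ⟨z, ?_⟩
    simpa using hz

/-! ### Colouring with `2 m` colours when `m` edges are missing -/

open Finset Classical in
/-- A graph on `2 m + 1` vertices missing `m` edges, all inside a set `S` of at most `m + 1`
vertices, has an edge colouring with `2 m` colours. -/
theorem SimpleGraph.lineGraph_colorable_of_le_compl {V : Type*} [Fintype V]
    {G D : SimpleGraph V} (hGD : G ≤ Dᶜ) {m : ℕ} (hm : 1 ≤ m) (hD : #D.edgeFinset = m)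
    (hV : Fintype.card V = 2 * m + 1) (S : Finset V) (hS : #S ≤ m + 1)
    (hDS : ∀ x y, D.Adj x y → x ∈ S) : G.lineGraph.Colorable (2 * m) := by
  have hK : Fintype.card D.Dart = 2 * m := by rw [D.dart_card_eq_twice_card_edges, hD]
  have hne : Nonempty D.Dart := Fintype.card_pos_iff.1 (by omega)
  -- The colours reserved to be missed at `v` in the final colouring.
  let F : V → Finset D.Dart := fun v => {d | d.fst = v}
  have hF : ∀ v, #(F v) = D.degree v := fun v => by
    rw [← D.dart_fst_fiber_card_eq_degree v]
  let Q : V → Finset V := fun v => {y ∈ S | Dᶜ.Adj v y}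
  have hQ : ∀ v ∈ S, D.degree v + #(Q v) + 1 = #S := by
    intro v hv
    have h1 : #({y ∈ S | ¬ Dᶜ.Adj v y}) = D.degree v + 1 := by
      rw [← D.card_neighborFinset_eq_degree, ← Finset.card_insert_of_notMem
        (s := D.neighborFinset v) (a := v) (by simp)]
      congr 1
      ext y
      simp only [Finset.mem_filter, SimpleGraph.compl_adj, Finset.mem_insert,
        D.mem_neighborFinset, not_and, not_not]
      constructor
      · rintro ⟨_, h⟩
        exact or_iff_not_imp_left.2 fun e => h fun e' => e e'.symm
      · rintro (rfl | h)
        · exact ⟨hv, fun h => (h rfl).elim⟩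
        · exact ⟨hDS y v h.symm, fun _ => h⟩
    have h2 := Finset.card_filter_add_card_filter_not (s := S) (fun y => Dᶜ.Adj v y)
    simp only [Q]
    omega
  let E : Finset (Sym2 V) := {e | e ∈ Dᶜ.edgeSet ∧ ∀ x ∈ e, x ∈ S}
  have hmemE : ∀ x y, s(x, y) ∈ E ↔ Dᶜ.Adj x y ∧ x ∈ S ∧ y ∈ S := fun x y => by
    simp [E]
  have hEv : ∀ v ∈ S, ({e ∈ E | v ∈ e} : Finset (Sym2 V)) = (Q v).image (fun y => s(v, y)) := by
    intro v hv
    ext e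
    simp only [Finset.mem_filter, Finset.mem_image, Q]
    constructor
    · rintro ⟨he, hve⟩
      obtain ⟨y, rfl⟩ := Sym2.mem_iff_exists.1 hve
      obtain ⟨h1, -, h2⟩ := (hmemE v y).1 he
      exact ⟨y, ⟨h2, h1⟩, rfl⟩
    · rintro ⟨y, ⟨h2, h1⟩, rfl⟩
      exact ⟨(hmemE v y).2 ⟨h1, hv, h2⟩, by simp⟩
  -- At `v ∈ S` the reserved colours and the edges of `Dᶜ` inside `S` together number `#S - 1`; the
  -- greedy bound holds because `#S ≤ m + 1`.
  obtain ⟨c, hc⟩ := exists_sym2_coloring_avoiding F (#S - 1) (by omega) E (by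
    rintro v ⟨e, he, hve⟩
    obtain ⟨y, rfl⟩ := Sym2.mem_iff_exists.1 hve
    have hv := ((hmemE v y).1 he).2.1
    have h1 := hQ v hv
    have h2 : #((Q v).image (fun y => s(v, y))) ≤ #(Q v) := Finset.card_image_le
    rw [hEv v hv, hF]
    omega)
  have hproper : ∀ x ∈ S, ∀ y ∈ S, ∀ z ∈ S, Dᶜ.Adj x y → Dᶜ.Adj x z → y ≠ z →
      c s(x, y) ≠ c s(x, z) := by
    intro x hx y hy z hz hxy hxz hyz
    refine (hc _ ((hmemE x y).2 ⟨hxy, hx, hy⟩) x (by simp)).2 _ ((hmemE x z).2 ⟨hxz, hx, hz⟩)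
      (by simp) ?_
    rw [Ne, Sym2.congr_right]
    exact hyz.symm
  let U : V → Finset D.Dart := fun v => F v ∪ (Q v).image (fun y => c s(v, y))
  have hmemU : ∀ x k, k ∈ U x ↔ k.fst = x ∨ ∃ y ∈ S, Dᶜ.Adj x y ∧ c s(x, y) = k := by
    intro x k
    simp [U, F, Q, and_assoc]
  have hcases : ∀ x ∈ S, ∀ y ∈ S, Dᶜ.Adj x y → (c s(x, y)).fst ≠ x := by
    intro x hx y hy hxy h
    refine (hc _ ((hmemE x y).2 ⟨hxy, hx, hy⟩) x (by simp)).1 ?_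
    simpa [F] using h
  -- Within `S`, colour `k` is withheld from its source and already present at `2 e` other vertices.
  -- The remaining `#S - 1 - 2 e` list it, a number of the parity of `2 m + 1 - #S` and, as `#S ≤ m
  -- + 1`, no larger.
  have hcount : ∀ k : D.Dart, ∃ e, #{x ∈ S | k ∈ univ \ U x} + 2 * e + 1 = #S := by
    intro k
    obtain ⟨H, hadj⟩ : ∃ H : SimpleGraph V, ∀ x y, H.Adj x y ↔
        (Dᶜ.Adj x y ∧ x ∈ S ∧ y ∈ S) ∧ c s(x, y) = k :=
      ⟨{ Adj := fun x y => (Dᶜ.Adj x y ∧ x ∈ S ∧ y ∈ S) ∧ c s(x, y) = k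
         symm := ⟨fun x y h => ⟨⟨h.1.1.symm, h.1.2.2, h.1.2.1⟩, by rw [Sym2.eq_swap]; exact h.2⟩⟩
         loopless := ⟨fun x h => Dᶜ.loopless.irrefl x h.1.1⟩ }, fun _ _ => Iff.rfl⟩
    have he := H.card_exists_adj_eq_two_mul_of_unique fun x y z hy hz => by
      obtain ⟨⟨hxy, hx, hy⟩, hyk⟩ := (hadj x y).1 hy
      obtain ⟨⟨hxz, -, hz⟩, hzk⟩ := (hadj x z).1 hz
      by_contra hyz
      exact hproper x hx y hy z hz hxy hxz hyz (hyk.trans hzk.symm)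
    refine ⟨#H.edgeFinset, ?_⟩
    have h1 : ({x ∈ S | ¬ k ∈ univ \ U x} : Finset V) =
        insert k.fst ({x | ∃ y, H.Adj x y} : Finset V) := by
      ext x
      simp only [Finset.mem_filter, Finset.mem_sdiff, Finset.mem_univ, true_and, not_not,
        Finset.mem_insert, hmemU, hadj]
      constructor
      · rintro ⟨hx, h | ⟨y, hy, h, hk⟩⟩
        · exact Or.inl h.symm
        · exact Or.inr ⟨y, ⟨h, hx, hy⟩, hk⟩
      · rintro (rfl | ⟨y, ⟨h, hx, hy⟩, hk⟩)
        · exact ⟨hDS _ _ k.adj, Or.inl rfl⟩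
        · exact ⟨hx, Or.inr ⟨y, hy, h, hk⟩⟩
    have h2 : k.fst ∉ ({x | ∃ y, H.Adj x y} : Finset V) := by
      simp only [Finset.mem_filter, Finset.mem_univ, true_and, not_exists, hadj]
      rintro y ⟨⟨h, hx, hy⟩, hk⟩
      exact hcases _ hx y hy h (by rw [hk])
    rw [← he, add_assoc, ← Finset.card_insert_of_notMem h2, ← h1,
      Finset.card_filter_add_card_filter_not]
  have hlist : Dᶜ.IsListedColoring S (2 * m + 1 - #S) (fun x y => c s(x, y))
      (fun x => univ \ U x) := by
    refine ⟨fun x y => by rw [Sym2.eq_swap], hproper, fun x hx y hy hxy => ?_, fun x hx => ?_,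
      fun k => ?_, fun k => ?_⟩
    · simp only [Finset.mem_sdiff, Finset.mem_univ, true_and, not_not, hmemU]
      exact Or.inr ⟨y, hy, hxy, rfl⟩
    · have h1 := hQ x hx
      have h2 : #(U x) = D.degree x + #(Q x) := by
        rw [Finset.card_union_of_disjoint, hF, Finset.card_image_of_injOn]
        · intro y hy z hz h
          by_contra hyz
          have hy := Finset.mem_filter.1 hy
          have hz := Finset.mem_filter.1 hz
          exact hproper x hx y hy.1 z hz.1 hy.2 hz.2 hyz h
        · rw [Finset.disjoint_left]
          intro k hk hk'
          obtain ⟨y, hy, rfl⟩ := Finset.mem_image.1 hk'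
          have hy := Finset.mem_filter.1 hy
          exact hcases x hx y hy.1 hy.2 (by simpa [F] using hk)
      rw [Finset.card_sdiff_of_subset (Finset.subset_univ _), Finset.card_univ, h2]
      omega
    · obtain ⟨e, he⟩ := hcount k
      omega
    · obtain ⟨e, he⟩ := hcount k
      omega
  obtain ⟨c', hs, hc'⟩ := hlist.exists_univ _ (by omega) (by omega)
  rw [← hK]
  exact SimpleGraph.lineGraph_colorable_of_symm c' hs
    fun x y z hxy hxz => hc' x y z (hGD hxy) (hGD hxz)

/-! ### Bounds for the edge chromatic number -/

open Finset Classical in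
/-- Each colour class on `2 m + 1` vertices has at most `m` edges. -/
theorem SimpleGraph.card_edgeFinset_le_of_lineGraph_colorable {V : Type*} [Fintype V]
    {G : SimpleGraph V} {m k : ℕ} (hV : Fintype.card V = 2 * m + 1)
    (h : G.lineGraph.Colorable k) : #G.edgeFinset ≤ k * m := by
  obtain ⟨C⟩ := h
  have hC : ∀ i, #{e | C e = i} ≤ m := by
    intro i
    obtain ⟨H, hH⟩ : ∃ H : SimpleGraph V, ∀ x y, H.Adj x y ↔
        ∃ h : s(x, y) ∈ G.edgeSet, C ⟨s(x, y), h⟩ = i :=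
      ⟨{ Adj := fun x y => ∃ h : s(x, y) ∈ G.edgeSet, C ⟨s(x, y), h⟩ = i
         symm := ⟨fun x y h => by rw [Sym2.eq_swap]; exact h⟩
         loopless := ⟨fun x h => G.loopless.irrefl x h.1⟩ }, fun _ _ => Iff.rfl⟩
    have h1 := H.card_exists_adj_eq_two_mul_of_unique fun x y z hy hz => by
      obtain ⟨hy, hyi⟩ := (hH x y).1 hy
      obtain ⟨hz, hzi⟩ := (hH x z).1 hz
      by_contra hyz
      refine C.valid (v := ⟨s(x, y), hy⟩) (w := ⟨s(x, z), hz⟩) ⟨?_, x, ?_⟩ (hyi.trans hzi.symm)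
      · rw [Ne, Subtype.mk.injEq, Sym2.congr_right]
        exact hyz
      · simp
    have h2 : #{x | ∃ y, H.Adj x y} ≤ Fintype.card V := Finset.card_le_univ _
    have h3 : #{e | C e = i} ≤ #H.edgeFinset := by
      refine Finset.card_le_card_of_injOn Subtype.val ?_ Subtype.val_injective.injOn
      rintro ⟨e, he⟩ hei
      induction e using Sym2.ind with
      | _ x y =>
        simp only [Finset.coe_filter, Finset.mem_univ, true_and, Set.mem_ofPred_eq] at hei
        simpa [hH] using ⟨he, hei⟩
    omega
  calc #G.edgeFinset = #(univ : Finset G.edgeSet) := by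
        rw [Finset.card_univ, SimpleGraph.edgeFinset_card]
    _ = ∑ i : Fin k, #{e | C e = i} :=
        Finset.card_eq_sum_card_fiberwise (fun _ _ => Finset.mem_coe.2 (Finset.mem_univ _))
    _ ≤ ∑ _i : Fin k, m := Finset.sum_le_sum fun i _ => hC i
    _ = k * m := by simp

/-- Number the vertices by residues modulo their number and colour an edge by the sum of its ends.
-/
theorem SimpleGraph.lineGraph_colorable_card {V : Type*} [Fintype V] [Nonempty V]
    (G : SimpleGraph V) : G.lineGraph.Colorable (Fintype.card V) := by
  have : NeZero (Fintype.card V) := ⟨Fintype.card_ne_zero⟩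
  let e := Fintype.equivFin V
  have := G.lineGraph_colorable_of_symm (K := Fin (Fintype.card V)) (fun x y => e x + e y)
    (fun x y => add_comm _ _) fun x y z _ _ hyz h => hyz (e.injective (add_left_cancel h))
  simpa using this

/-- For cliques of sizes `2 p` and `2 q` this says that the `2 (p² + q²) - (p + q)` missing edges
number at least `m + 1 = 2 p q + p + q`. -/
theorem add_add_mul_le_of_not_both_one {p q : ℕ} (hp : 1 ≤ p) (hq : 1 ≤ q)
    (h : ¬ (p = 1 ∧ q = 1)) : p + q + p * q ≤ p * p + q * q := by
  obtain ⟨x, rfl⟩ := Nat.exists_eq_add_of_le' hp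
  obtain ⟨y, rfl⟩ := Nat.exists_eq_add_of_le' hq
  rcases lt_trichotomy x y with hxy | rfl | hxy
  · obtain ⟨z, rfl⟩ := Nat.exists_eq_add_of_lt hxy
    nlinarith
  · have : 1 ≤ x := by omega
    nlinarith
  · obtain ⟨z, rfl⟩ := Nat.exists_eq_add_of_lt hxy
    nlinarith

/-! ### The Class 2 criterion for a complete graph minus two cliques -/

open Finset Classical in
/-- The complete join of `K_n` with `K_{a,b}`, where `a` and `b` are even and `n = a b - 1`, is
Class 2 if and only if `a = b = 2`. -/
theorem SimpleGraph.isClassTwo_iff_of_adj_iff {V : Type*} [Fintype V] {G : SimpleGraph V}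
    {A B : Finset V} (hAB : Disjoint A B)
    (hG : ∀ x y, G.Adj x y ↔ x ≠ y ∧ ¬ (x ∈ A ∧ y ∈ A) ∧ ¬ (x ∈ B ∧ y ∈ B))
    (hV : Fintype.card V + 1 = #A * #B + #A + #B) (hA : 2 ≤ #A) (hB : 2 ≤ #B)
    (hA' : Even #A) (hB' : Even #B) : G.IsClassTwo ↔ #A = 2 ∧ #B = 2 := by
  obtain ⟨p, hp⟩ := even_iff_exists_two_mul.1 hA'
  obtain ⟨q, hq⟩ := even_iff_exists_two_mul.1 hB'
  have hp1 : 1 ≤ p := by omega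
  have hq1 : 1 ≤ q := by omega
  -- This is `(p - 1) (q - 1) ≥ 0`; it gives `#(A ∪ B) ≤ m + 1` below.
  have hpq : p + q ≤ p * q + 1 := by nlinarith
  have hABpq : #A * #B = 4 * (p * q) := by rw [hp, hq]; ring
  obtain ⟨m, hm⟩ : ∃ m, Fintype.card V = 2 * m + 1 := ⟨2 * (p * q) + p + q - 1, by omega⟩
  have hmpq : m + 1 = 2 * (p * q) + p + q := by omega
  have hcompl : ∀ x y, Gᶜ.Adj x y ↔ x ≠ y ∧ ((x ∈ A ∧ y ∈ A) ∨ (x ∈ B ∧ y ∈ B)) := by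
    intro x y
    rw [SimpleGraph.compl_adj, hG]
    tauto
  have hdegA : ∀ x ∈ A, Gᶜ.degree x = #A - 1 := by
    intro x hx
    rw [← SimpleGraph.card_neighborFinset_eq_degree, ← Finset.card_erase_of_mem hx]
    congr 1
    ext y
    have := Finset.disjoint_left.1 hAB hx
    simp only [SimpleGraph.mem_neighborFinset, hcompl, Finset.mem_erase]
    tauto
  have hdegB : ∀ x ∈ B, Gᶜ.degree x = #B - 1 := by
    intro x hx
    rw [← SimpleGraph.card_neighborFinset_eq_degree, ← Finset.card_erase_of_mem hx]
    congr 1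
    ext y
    have := Finset.disjoint_right.1 hAB hx
    simp only [SimpleGraph.mem_neighborFinset, hcompl, Finset.mem_erase]
    tauto
  have hsum : 2 * #Gᶜ.edgeFinset = #A * (#A - 1) + #B * (#B - 1) := by
    rw [← Gᶜ.sum_degrees_eq_twice_card_edges, ← Finset.sum_subset (Finset.subset_univ (A ∪ B)),
      Finset.sum_union hAB, Finset.sum_const_nat hdegA, Finset.sum_const_nat hdegB]
    intro x _ hx
    rw [Finset.mem_union, not_or] at hx
    rw [← SimpleGraph.card_neighborFinset_eq_degree, Finset.card_eq_zero]
    refine Finset.eq_empty_of_forall_notMem fun y hy => ?_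
    rw [SimpleGraph.mem_neighborFinset, hcompl] at hy
    tauto
  have hedges : #Gᶜ.edgeFinset + (p + q) = 2 * (p * p + q * q) := by
    rw [hp, hq] at hsum
    obtain ⟨p, rfl⟩ := Nat.exists_eq_add_of_le' hp1
    obtain ⟨q, rfl⟩ := Nat.exists_eq_add_of_le' hq1
    rw [show 2 * (p + 1) - 1 = 2 * p + 1 by omega, show 2 * (q + 1) - 1 = 2 * q + 1 by omega] at hsum
    nlinarith
  have hdeg : G.supDegree = (2 * m : ℕ) := by
    have hcard : ∀ x : V, ({x}ᶜ : Set V).encard = (2 * m : ℕ) := fun x => by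
      rw [← Finset.coe_singleton, ← Finset.coe_compl, Set.encard_coe_eq_coe_finsetCard,
        Finset.card_compl, hm, Finset.card_singleton]
      rfl
    refine le_antisymm (iSup_le fun x => ?_) ?_
    · rw [← hcard x]
      exact Set.encard_le_encard fun y hy => fun e => G.ne_of_adj hy e.symm
    -- A vertex outside both cliques is joined to all others and attains degree `2 m`.
    · obtain ⟨u, hu⟩ : ∃ u, u ∉ A ∪ B := by
        by_contra! h
        have h1 := (Finset.card_eq_iff_eq_univ _).2 (Finset.eq_univ_of_forall h)
        have h2 := Finset.card_union_le A B
        omega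
      refine le_trans ?_ (le_iSup _ u)
      rw [← hcard u]
      refine Set.encard_le_encard fun y hy => ?_
      rw [Finset.mem_union, not_or] at hu
      rw [SimpleGraph.mem_neighborSet, hG]
      exact ⟨fun e => hy e.symm, fun h => hu.1 h.1, fun h => hu.2 h.1⟩
  have hclass : G.IsClassTwo ↔ G.edgeChromaticNumber = (2 * m + 1 : ℕ) := by
    rw [SimpleGraph.IsClassTwo, hdeg, and_iff_right (ENat.natCast_ne_top _), Nat.cast_add, Nat.cast_one]
  rw [hclass]
  constructor
  · intro hχ
    by_contra hne
    have hle : m ≤ #Gᶜ.edgeFinset := by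
      have h := add_add_mul_le_of_not_both_one hp1 hq1 (by omega)
      omega
    obtain ⟨D₀, hD₀, hD₀m⟩ := Finset.exists_subset_card_eq hle
    have hD₀adj : ∀ x y, s(x, y) ∈ D₀ → Gᶜ.Adj x y := fun x y h => by
      simpa using hD₀ h
    have hcol : G.lineGraph.Colorable (2 * m) := by
      refine SimpleGraph.lineGraph_colorable_of_le_compl
        (D := SimpleGraph.fromEdgeSet (D₀ : Set (Sym2 V))) ?_ (by omega) ?_ hm (A ∪ B) ?_ ?_
      · intro x y h
        rw [SimpleGraph.compl_adj, SimpleGraph.fromEdgeSet_adj]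
        exact ⟨h.ne, fun h' => ((SimpleGraph.compl_adj _ _ _).1 (hD₀adj x y h'.1)).2 h⟩
      · rw [← hD₀m]
        congr 1
        ext e
        induction e using Sym2.ind with
        | _ x y =>
          simp only [SimpleGraph.mem_edgeFinset, SimpleGraph.mem_edgeSet,
            SimpleGraph.fromEdgeSet_adj, Finset.mem_coe, and_iff_left_iff_imp]
          exact fun h => (hD₀adj x y h).ne
      · have := Finset.card_union_le A B
        omega
      · intro x y h
        have := (hcompl x y).1 (hD₀adj x y ((SimpleGraph.fromEdgeSet_adj _).1 h).1)
        rw [Finset.mem_union]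
        tauto
    have := hcol.chromaticNumber_le
    rw [SimpleGraph.edgeChromaticNumber] at hχ
    rw [hχ] at this
    have : 2 * m + 1 ≤ 2 * m := by exact_mod_cast this
    omega
  · rintro ⟨ha, hb⟩
    obtain rfl : p = 1 := by omega
    obtain rfl : q = 1 := by omega
    obtain rfl : m = 3 := by omega
    have : Nonempty V := Fintype.card_pos_iff.1 (by omega)
    refine le_antisymm ?_ ?_
    · rw [← hm]
      exact G.lineGraph_colorable_card.chromaticNumber_le
    · refine SimpleGraph.le_chromaticNumber_iff_colorable.2 fun k hk => ?_
      -- Seven vertices with two missing edges leave 19 edges, more than the `6 * 3` that six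
      -- colours can cover.
      have h1 := SimpleGraph.card_edgeFinset_le_of_lineGraph_colorable hm hk
      have h2 : 2 * #G.edgeFinset + 2 * #Gᶜ.edgeFinset = 7 * 6 := by
        rw [← G.sum_degrees_eq_twice_card_edges, ← Gᶜ.sum_degrees_eq_twice_card_edges,
          ← Finset.sum_add_distrib, Finset.sum_const_nat (m := 6), Finset.card_univ, hm]
        intro x _
        have h3 := G.degree_compl x
        have h4 := G.degree_lt_card_verts x
        omega
      have : 2 * 3 + 1 ≤ k := by omega
      exact_mod_cast this

/-! ### Essential annihilators in products of Artinian local rings -/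

theorem Ideal.mul_eq_top_iff_and {R : Type*} [CommRing R] (I J : Ideal R) :
    I * J = ⊤ ↔ I = ⊤ ∧ J = ⊤ :=
  ⟨fun h => ⟨top_le_iff.1 (h ▸ Ideal.mul_le_left), top_le_iff.1 (h ▸ Ideal.mul_le_right)⟩,
    by rintro ⟨rfl, rfl⟩; simp⟩

theorem Ideal.annihilator_prod {R S : Type*} [CommRing R] [CommRing S] (I : Ideal R)
    (J : Ideal S) : Submodule.annihilator (Ideal.prod I J) =
      Ideal.prod (Submodule.annihilator I) (Submodule.annihilator J) := by
  ext ⟨r, s⟩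
  simp only [Submodule.mem_annihilator, Ideal.mem_prod, smul_eq_mul, Prod.forall, Prod.mk_mul_mk,
    Prod.mk_eq_zero]
  refine ⟨fun h => ⟨fun x hx => (h x 0 ⟨hx, J.zero_mem⟩).1, fun y hy => (h 0 y ⟨I.zero_mem, hy⟩).2⟩,
    fun h x y hxy => ⟨h.1 x hxy.1, h.2 y hxy.2⟩⟩

theorem Ideal.prod_mul_prod {R S : Type*} [CommRing R] [CommRing S] (I I' : Ideal R)
    (J J' : Ideal S) : Ideal.prod I J * Ideal.prod I' J' = Ideal.prod (I * I') (J * J') := by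
  rw [Ideal.ideal_prod_eq (Ideal.prod I J * Ideal.prod I' J'), Ideal.map_mul, Ideal.map_mul]
  simp

theorem Ideal.prod_inf_prod {R S : Type*} [CommRing R] [CommRing S] (I I' : Ideal R)
    (J J' : Ideal S) : Ideal.prod I J ⊓ Ideal.prod I' J' = Ideal.prod (I ⊓ I') (J ⊓ J') := by
  ext ⟨r, s⟩
  simp only [Submodule.mem_inf, Ideal.mem_prod]
  tauto

/-- Every ideal of the product is a product of ideals; testing on those with one zero factor
separates the coordinates. -/
theorem Ideal.isEssentialIdeal_prod_iff {R S : Type*} [CommRing R] [CommRing S] [Nontrivial R]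
    [Nontrivial S] (I : Ideal R) (J : Ideal S) :
    (Ideal.prod I J).IsEssentialIdeal ↔ I.IsEssentialIdeal ∧ J.IsEssentialIdeal := by
  constructor
  · rintro ⟨-, h⟩
    have h1 : ∀ K : Ideal R, K ≠ ⊥ → I ⊓ K ≠ ⊥ := fun K hK e =>
      h (Ideal.prod K ⊥) (by simp [hK]) (by simp [Ideal.prod_inf_prod, e])
    have h2 : ∀ K : Ideal S, K ≠ ⊥ → J ⊓ K ≠ ⊥ := fun K hK e =>
      h (Ideal.prod ⊥ K) (by simp [hK]) (by simp [Ideal.prod_inf_prod, e])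
    exact ⟨⟨by simpa using h1 ⊤ top_ne_bot, h1⟩, ⟨by simpa using h2 ⊤ top_ne_bot, h2⟩⟩
  · rintro ⟨⟨hI, h1⟩, ⟨-, h2⟩⟩
    refine ⟨by simp [hI], fun K hK e => hK ?_⟩
    rw [Ideal.ideal_prod_eq K, Ideal.prod_inf_prod, Ideal.prod_eq_bot_iff] at e
    rw [Ideal.ideal_prod_eq K, Ideal.prod_eq_bot_iff]
    exact ⟨not_not.1 fun h => h1 _ h e.1, not_not.1 fun h => h2 _ h e.2⟩

/-- In an Artinian local ring every non-zero ideal contains a non-zero ideal killed by the maximal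
ideal. -/
theorem Ideal.exists_le_mul_maximalIdeal_eq_bot {R : Type*} [CommRing R] [IsArtinianRing R]
    [IsLocalRing R] (J : Ideal R) (hJ : J ≠ ⊥) :
    ∃ K ≤ J, K ≠ ⊥ ∧ K * IsLocalRing.maximalIdeal R = ⊥ := by
  classical
  obtain ⟨n, hn⟩ := IsArtinianRing.isNilpotent_jacobson_bot (R := R)
  rw [IsLocalRing.jacobson_eq_maximalIdeal ⊥ bot_ne_top] at hn
  have hex : ∃ n, J * IsLocalRing.maximalIdeal R ^ n = ⊥ := ⟨n, by rw [hn]; simp⟩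
  -- Just before powers of the nilpotent maximal ideal first annihilate `J`, the product is still
  -- non-zero.
  obtain ⟨k, hk⟩ : ∃ k, Nat.find hex = k + 1 := by
    refine Nat.exists_eq_succ_of_ne_zero fun h => hJ ?_
    simpa [h] using Nat.find_spec hex
  refine ⟨J * IsLocalRing.maximalIdeal R ^ k, Ideal.mul_le_left,
    Nat.find_min hex (by omega), ?_⟩
  rw [mul_assoc, ← pow_succ, ← hk]
  exact Nat.find_spec hex

theorem Ideal.annihilator_top_eq_bot {R : Type*} [CommRing R] :
    Submodule.annihilator (⊤ : Ideal R) = ⊥ := by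
  rw [Submodule.annihilator_top]
  exact Module.annihilator_eq_bot.2 inferInstance

theorem Ideal.annihilator_isEssentialIdeal_iff {R : Type*} [CommRing R] [IsArtinianRing R]
    [IsLocalRing R] (I : Ideal R) : (Submodule.annihilator I).IsEssentialIdeal ↔ I ≠ ⊤ := by
  constructor
  · rintro ⟨h, -⟩ rfl
    exact h Ideal.annihilator_top_eq_bot
  · intro hI
    have h : ∀ J : Ideal R, J ≠ ⊥ → Submodule.annihilator I ⊓ J ≠ ⊥ := by
      intro J hJ e
      obtain ⟨K, hKJ, hK, hKm⟩ := Ideal.exists_le_mul_maximalIdeal_eq_bot J hJ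
      refine hK (le_bot_iff.1 (e ▸ le_inf ?_ hKJ))
      rw [Submodule.le_annihilator_iff, smul_eq_mul, ← le_bot_iff, ← hKm]
      exact Ideal.mul_mono_right (IsLocalRing.le_maximalIdeal hI)
    exact ⟨by simpa using h ⊤ top_ne_bot, h⟩

theorem Ideal.annihilator_ne_bot_iff {R : Type*} [CommRing R] [IsArtinianRing R]
    [IsLocalRing R] (I : Ideal R) : Submodule.annihilator I ≠ ⊥ ↔ I ≠ ⊤ :=
  ⟨by rintro h rfl; exact h Ideal.annihilator_top_eq_bot,
    fun h => ((Ideal.annihilator_isEssentialIdeal_iff I).2 h).1⟩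

section

variable {R S : Type*} [CommRing R] [CommRing S]
  [IsArtinianRing R] [IsLocalRing R] [IsArtinianRing S] [IsLocalRing S]

/-- The vertices as the pairs of ideals other than `(⊥, ⊥)` and `(⊤, ⊤)`. -/
noncomputable def nonzeroAnnihilatingIdealProdEquiv :
    NonzeroAnnihilatingIdeal (R × S) ≃ {x : Ideal R × Ideal S // x ≠ ⊥ ∧ x ≠ ⊤} :=
  Ideal.idealProdEquiv.toEquiv.subtypeEquiv fun I => by
    have h : I ≠ ⊥ ↔ Ideal.idealProdEquiv I ≠ ⊥ := by simp
    have h' : Submodule.annihilator I ≠ ⊥ ↔ Ideal.idealProdEquiv I ≠ ⊤ := by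
      obtain ⟨⟨I, J⟩, rfl⟩ := Ideal.idealProdEquiv.symm.surjective I
      rw [OrderIso.apply_symm_apply, Ideal.idealProdEquiv_symm_apply, Ideal.annihilator_prod,
        Ne, Ideal.prod_eq_bot_iff, Ne, Prod.ext_iff]
      have h1 := (Ideal.annihilator_ne_bot_iff I).not_right
      have h2 := (Ideal.annihilator_ne_bot_iff J).not_right
      simp only [Prod.fst_top, Prod.snd_top]
      tauto
    exact and_congr h h'

theorem essentialAnnihilatingIdealGraph_prod_adj_iff (I J : NonzeroAnnihilatingIdeal (R × S)) :
    (essentialAnnihilatingIdealGraph (R × S)).Adj I J ↔ I ≠ J ∧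
      ¬ ((nonzeroAnnihilatingIdealProdEquiv I).1.1 = ⊤ ∧
        (nonzeroAnnihilatingIdealProdEquiv J).1.1 = ⊤) ∧
      ¬ ((nonzeroAnnihilatingIdealProdEquiv I).1.2 = ⊤ ∧
        (nonzeroAnnihilatingIdealProdEquiv J).1.2 = ⊤) := by
  refine and_congr_right fun _ => ?_
  change (Submodule.annihilator (I.1 * J.1)).IsEssentialIdeal ↔
    ¬ ((Ideal.idealProdEquiv I.1).1 = ⊤ ∧ (Ideal.idealProdEquiv J.1).1 = ⊤) ∧
    ¬ ((Ideal.idealProdEquiv I.1).2 = ⊤ ∧ (Ideal.idealProdEquiv J.1).2 = ⊤)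
  obtain ⟨⟨I₁, I₂⟩, hI⟩ := Ideal.idealProdEquiv.symm.surjective I.1
  obtain ⟨⟨J₁, J₂⟩, hJ⟩ := Ideal.idealProdEquiv.symm.surjective J.1
  rw [← hI, ← hJ, OrderIso.apply_symm_apply, OrderIso.apply_symm_apply,
    Ideal.idealProdEquiv_symm_apply, Ideal.idealProdEquiv_symm_apply, Ideal.prod_mul_prod,
    Ideal.annihilator_prod, Ideal.isEssentialIdeal_prod_iff,
    Ideal.annihilator_isEssentialIdeal_iff, Ideal.annihilator_isEssentialIdeal_iff]
  rw [Ne, Ne, Ideal.mul_eq_top_iff_and, Ideal.mul_eq_top_iff_and]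

end

theorem Finite.of_encard_setOf_ne {α : Type*} {a : α} {t : ℕ} (h : {x : α | x ≠ a}.encard = t) :
    Finite α := by
  have h1 : {x : α | x ≠ a}.Finite := Set.finite_of_encard_eq_coe h
  refine Set.finite_univ_iff.1 ((h1.insert a).subset fun x _ => ?_)
  by_cases hx : x = a
  · exact Or.inl hx
  · exact Or.inr hx

/-! ### The graph of `R₁ × R₂` as a complete graph minus two cliques -/

open Finset Classical in
theorem mainTheorem9 {R₁ R₂ : Type*} [CommRing R₁] [CommRing R₂]
    [IsArtinianRing R₁] [IsLocalRing R₁] [IsArtinianRing R₂] [IsLocalRing R₂]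
    (t₁ t₂ : ℕ)
    (ht₁ : {I : Ideal R₁ | I ≠ ⊤}.encard = t₁) (ht₂ : {I : Ideal R₂ | I ≠ ⊤}.encard = t₂)
    (two_le₁ : 2 ≤ t₁) (two_le₂ : 2 ≤ t₂) (even₁ : Even t₁) (even₂ : Even t₂) :
    (essentialAnnihilatingIdealGraph (R₁ × R₂)).IsClassTwo ↔ t₁ = 2 ∧ t₂ = 2 := by
  have := Finite.of_encard_setOf_ne ht₁
  have := Finite.of_encard_setOf_ne ht₂
  have := Fintype.ofFinite (Ideal R₁)
  have := Fintype.ofFinite (Ideal R₂)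
  have hc₁ : #{I : Ideal R₁ | I ≠ ⊤} = t₁ := by
    rw [← Finset.coe_filter_univ, Set.encard_coe_eq_coe_finsetCard] at ht₁
    exact_mod_cast ht₁
  have hc₂ : #{I : Ideal R₂ | I ≠ ⊤} = t₂ := by
    rw [← Finset.coe_filter_univ, Set.encard_coe_eq_coe_finsetCard] at ht₂
    exact_mod_cast ht₂
  let W := {x : Ideal R₁ × Ideal R₂ // x ≠ ⊥ ∧ x ≠ ⊤}
  let e : NonzeroAnnihilatingIdeal (R₁ × R₂) ≃ W := nonzeroAnnihilatingIdealProdEquiv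
  have : Fintype (NonzeroAnnihilatingIdeal (R₁ × R₂)) := Fintype.ofEquiv W e.symm
  have hcard : Fintype.card (NonzeroAnnihilatingIdeal (R₁ × R₂)) + 1 = t₁ * t₂ + t₁ + t₂ := by
    have h1 : Fintype.card (Ideal R₁) = t₁ + 1 := by
      rw [← hc₁, Finset.filter_ne', Finset.card_erase_add_one (Finset.mem_univ _),
        Finset.card_univ]
    have h2 : Fintype.card (Ideal R₂) = t₂ + 1 := by
      rw [← hc₂, Finset.filter_ne', Finset.card_erase_add_one (Finset.mem_univ _),
        Finset.card_univ]
    have h3 : (Finset.univ.filter fun x : Ideal R₁ × Ideal R₂ => x ≠ ⊥ ∧ x ≠ ⊤) =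
        (Finset.univ.erase ⊤).erase ⊥ := by
      ext; simp
    rw [Fintype.card_congr e, Fintype.card_subtype, h3, Finset.card_erase_of_mem (by simp),
      Finset.card_erase_of_mem (by simp), Finset.card_univ, Fintype.card_prod, h1, h2]
    have : (t₁ + 1) * (t₂ + 1) = t₁ * t₂ + t₁ + t₂ + 1 := by ring
    omega
  let A : Finset (NonzeroAnnihilatingIdeal (R₁ × R₂)) := {v | (e v).1.1 = ⊤}
  let B : Finset (NonzeroAnnihilatingIdeal (R₁ × R₂)) := {v | (e v).1.2 = ⊤}
  -- The sizes are crossed: with first coordinate `⊤`, the second runs over all proper ideals of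
  -- `R₂`, since `(⊤, ⊤)` is not a vertex.
  have hA : #A = t₂ := by
    rw [← hc₂]
    refine Finset.card_bij (fun v _ => (e v).1.2) (fun v hv => ?_) (fun v hv w hw h => ?_)
      fun J hJ => ?_
    · simp only [A, Finset.mem_filter, Finset.mem_univ, true_and] at hv ⊢
      exact fun h => (e v).2.2 (Prod.ext hv h)
    · simp only [A, Finset.mem_filter, Finset.mem_univ, true_and] at hv hw
      exact e.injective (Subtype.ext (Prod.ext (hv.trans hw.symm) h))
    · simp only [Finset.mem_filter, Finset.mem_univ, true_and] at hJ
      refine ⟨e.symm ⟨(⊤, J), fun h => top_ne_bot (congrArg Prod.fst h),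
        fun h => hJ (congrArg Prod.snd h)⟩, ?_, ?_⟩ <;> simp [A]
  have hB : #B = t₁ := by
    rw [← hc₁]
    refine Finset.card_bij (fun v _ => (e v).1.1) (fun v hv => ?_) (fun v hv w hw h => ?_)
      fun J hJ => ?_
    · simp only [B, Finset.mem_filter, Finset.mem_univ, true_and] at hv ⊢
      exact fun h => (e v).2.2 (Prod.ext h hv)
    · simp only [B, Finset.mem_filter, Finset.mem_univ, true_and] at hv hw
      exact e.injective (Subtype.ext (Prod.ext h (hv.trans hw.symm)))
    · simp only [Finset.mem_filter, Finset.mem_univ, true_and] at hJ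
      refine ⟨e.symm ⟨(J, ⊤), fun h => top_ne_bot (congrArg Prod.snd h),
        fun h => hJ (congrArg Prod.fst h)⟩, ?_, ?_⟩ <;> simp [B]
  have hAB : Disjoint A B := by
    rw [Finset.disjoint_left]
    intro v hv hv'
    simp only [A, B, Finset.mem_filter, Finset.mem_univ, true_and] at hv hv'
    exact (e v).2.2 (Prod.ext hv hv')
  rw [SimpleGraph.isClassTwo_iff_of_adj_iff hAB, hA, hB, and_comm]
  · intro I J
    rw [essentialAnnihilatingIdealGraph_prod_adj_iff]
    simp [A, B, e]
  · rw [hA, hB, hcard]; ring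
  · rwa [hA]
  · rwa [hB]
  · rwa [hA]
  · rwa [hB]
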